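/- Let $X$ be a real $n\times d$ matrix with rows $x_1,\dots,x_n\in\mathbb{R}^d$, let $\varphi\in[0,1]$, and let $\xi=\max_i\|x_i\|$ (Euclidean norm; if $\xi=0$, read $\xi^{-1}$ as $0$). Let $B$ be the augmented covariate matrix $$B=\begin{bmatrix}\sqrt{\varphi}\,I_n\\ \xi^{-1}\sqrt{1-\varphi}\,X^{\top}\end{bmatrix}\in\mathbb{R}^{(n+d)\times n}.$$ The Gram–Schmidt Walk design is the law of the random vector $z\in\{-1,1\}^n$ returned by the following procedure. Start from $z_1=0\in\mathbb{R}^n$ with no pivot. While $z_t\notin\{-1,1\}^n$, let $A_t=\{i:|z_t(i)|<1\}$. If there is a previous pivot and it lies in $A_t$, keep it as the pivot $p_t$; otherwise draw $p_t$ uniformly at random from $A_t$. Let $u_t$ be a minimizer of $\|Bu\|$ over all $u\in\mathbb{R}^n$ with $u(p_t)=1$ and $u(i)=0$ for $i\notin A_t$ (if the minimizer is not unique, which can only happen for $\varphi=0$, it is selected by an arbitrary fixed rule depending on $z_t$ and $p_t$). Let $\Delta_t=\{\delta\in\mathbb{R}: z_t+\delta u_t\in[-1,1]^n\}$, $\delta_t^+=|\max\Delta_t|$,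 $\delta_t^-=|\min\Delta_t|$. Draw $\delta_t=\delta_t^+$ with probability $\delta_t^- /(\delta_t^++\delta_t^-)$ and $\delta_t=-\delta_t^-$ with probability $\delta_t^+/(\delta_t^++\delta_t^-)$, and set $z_{t+1}=z_t+\delta_t u_t$. (The procedure stops after at most $n$ iterations.) Let $P$ be the matrix of the orthogonal projection of $\mathbb{R}^{n+d}$ onto the column space of $B$. Then, under the Gram–Schmidt Walk design, $$\operatorname{Cov}(Bz)\preceq P,$$ that is, $P-\operatorname{Cov}(Bz)$ is positive semidefinite. -/

import Mathlib

noncomputable section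

namespace GSW

variable {n d : ℕ} {ι : Type*} [Fintype ι]

/-- The largest Euclidean norm `ξ = max_i ‖x_i‖` of the rows of the covariate matrix
(it is `0` when there are no units). -/
def maxRowNorm (X : Matrix (Fin n) (Fin d) ℝ) : ℝ :=
  ⨆ i, ‖(WithLp.toLp 2 (X i) : EuclideanSpace ℝ (Fin d))‖

/-- The augmented covariate matrix, of size `(n + d) × n`. Its `i`-th column is
`(√φ e_i, ξ⁻¹ √(1 - φ) x_i)`. -/
def augmented (X : Matrix (Fin n) (Fin d) ℝ) (φ : ℝ) : Matrix (Fin n ⊕ Fin d) (Fin n) ℝ :=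
  Matrix.fromRows (√φ • (1 : Matrix (Fin n) (Fin n) ℝ))
    (((maxRowNorm X)⁻¹ * √(1 - φ)) • X.transpose)

/-- The units whose current fractional assignment is not yet integral. -/
def alive (z : Fin n → ℝ) : Finset (Fin n) :=
  Finset.univ.filter fun i => |z i| < 1

/-- `u` minimizes `‖B u‖` among the vectors with `u p = 1` that vanish outside `A`. -/
structure IsStepDirection (B : Matrix ι (Fin n) ℝ) (A : Finset (Fin n)) (p : Fin n)
    (u : Fin n → ℝ) : Prop where
  pivot_eq_one : u p = 1
  eq_zero_of_notMem : ∀ i, i ∉ A → u i = 0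
  norm_le : ∀ w : Fin n → ℝ, w p = 1 → (∀ i, i ∉ A → w i = 0) →
    ‖(WithLp.toLp 2 (B.mulVec u) : EuclideanSpace ℝ ι)‖ ≤
      ‖(WithLp.toLp 2 (B.mulVec w) : EuclideanSpace ℝ ι)‖

/-- A rule that returns, for the current fractional assignments `z` and the current pivot `p`,
a step direction. The direction is unique if the columns of `B` are linearly independent;
otherwise the rule breaks ties between the minimizers, in an arbitrary way. -/
def IsDirectionRule (B : Matrix ι (Fin n) ℝ) (dir : (Fin n → ℝ) → Fin n → Fin n → ℝ) : Prop :=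
  ∀ z p, p ∈ alive z → IsStepDirection B (alive z) p (dir z p)

/-- The step sizes that keep the fractional assignments in the cube `[-1, 1]ⁿ`. -/
def feasibleSteps (z u : Fin n → ℝ) : Set ℝ :=
  {δ | ∀ i, z i + δ * u i ∈ Set.Icc (-1 : ℝ) 1}

/-- `δ⁺ = |max Δ|` -/
def stepPlus (z u : Fin n → ℝ) : ℝ := |sSup (feasibleSteps z u)|

/-- `δ⁻ = |min Δ|` -/
def stepMinus (z u : Fin n → ℝ) : ℝ := |sInf (feasibleSteps z u)|

/-- The probability `δ⁻ / (δ⁺ + δ⁻)` of taking the step `δ⁺`. -/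
def probPlus (z u : Fin n → ℝ) : NNReal :=
  Real.toNNReal (stepMinus z u / (stepPlus z u + stepMinus z u))

theorem probPlus_le_one (z u : Fin n → ℝ) : probPlus z u ≤ 1 := by
  unfold probPlus
  rw [Real.toNNReal_le_one]
  apply div_le_one_of_le₀
  · have : 0 ≤ stepPlus z u := abs_nonneg _
    linarith
  · exact add_nonneg (abs_nonneg _) (abs_nonneg _)

/-- The random step size: `δ⁺` with probability `δ⁻ / (δ⁺ + δ⁻)`, and `-δ⁻` with the
complementary probability. -/
def stepSize (z u : Fin n → ℝ) : PMF ℝ :=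
  (PMF.ofFintype (fun b : Bool => if b then (probPlus z u : ENNReal) else 1 - probPlus z u)
    (by simp [add_tsub_cancel_of_le, probPlus_le_one z u])).map fun b =>
      if b then stepPlus z u else -stepMinus z u

/-- The pivot of an iteration: the previous pivot if there is one and it is still in `A`, and
otherwise a uniformly random element of `A`. -/
def choosePivot (A : Finset (Fin n)) (hA : A.Nonempty) : Option (Fin n) → PMF (Fin n)
  | none => PMF.uniformOfFinset A hA
  | some p => if p ∈ A then PMF.pure p else PMF.uniformOfFinset A hA

/-- The state of the algorithm: the fractional assignments and the last pivot (`none` before the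
first iteration). -/
abbrev State (n : ℕ) : Type := (Fin n → ℝ) × Option (Fin n)

open Classical in
/-- One iteration of the Gram–Schmidt Walk; nothing happens once all assignments are integral. -/
def iteration (dir : (Fin n → ℝ) → Fin n → Fin n → ℝ) (s : State n) : PMF (State n) :=
  if hA : (alive s.1).Nonempty then
    (choosePivot (alive s.1) hA s.2).bind fun p =>
      (stepSize s.1 (dir s.1 p)).map fun δ => (s.1 + δ • dir s.1 p, some p)
  else PMF.pure s

/-- The law of the state after `t` iterations, started from the assignments `0` with no pivot. -/
def stateLaw (dir : (Fin n → ℝ) → Fin n → Fin n → ℝ) : ℕ → PMF (State n)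
  | 0 => PMF.pure (0, none)
  | t + 1 => (stateLaw dir t).bind (iteration dir)

/-- The Gram–Schmidt Walk design: the law of the assignment vector that the walk returns. Every
iteration makes at least one more assignment integral, so the walk has stopped after at most `n`
iterations (`design_integral`). -/
def design (dir : (Fin n → ℝ) → Fin n → Fin n → ℝ) : PMF (Fin n → ℝ) :=
  (stateLaw dir n).map Prod.fst

/-- The covariance matrix of the random vector `B z`, where `z` has law `q`. -/
def covMulVec (B : Matrix ι (Fin n) ℝ) (q : PMF (Fin n → ℝ)) : Matrix ι ι ℝ :=
  Matrix.of fun i j =>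
    ProbabilityTheory.covariance (fun z => B.mulVec z i) (fun z => B.mulVec z j) q.toMeasure

/-- The column space of `B`, as a subspace of Euclidean space. -/
def colSpace (B : Matrix ι (Fin n) ℝ) : Submodule ℝ (EuclideanSpace ℝ ι) :=
  Submodule.span ℝ (Set.range fun k => (WithLp.toLp 2 (B.col k) : EuclideanSpace ℝ ι))

/-- The matrix, in the standard basis, of the orthogonal projection onto the column space. -/
def colProj [DecidableEq ι] (B : Matrix ι (Fin n) ℝ) : Matrix ι ι ℝ :=
  (Matrix.toEuclideanCLM (𝕜 := ℝ) (n := ι)).symm (colSpace B).starProjection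

/-! ### The definitions make sense: step directions exist, and the walk ends within `n` steps -/

theorem mem_alive {z : Fin n → ℝ} {i : Fin n} : i ∈ alive z ↔ |z i| < 1 := by simp [alive]

theorem exists_isStepDirection (B : Matrix ι (Fin n) ℝ) (A : Finset (Fin n)) (p : Fin n)
    (hp : p ∈ A) : ∃ u, IsStepDirection B A p u := by
  classical
  let W : Submodule ℝ (Fin n → ℝ) :=
    { carrier := {w | w p = 0 ∧ ∀ i, i ∉ A → w i = 0}
      add_mem' := by
        rintro a b ⟨h1, h2⟩ ⟨h3, h4⟩
        exact ⟨by simp [h1, h3], fun i hi => by simp [h2 i hi, h4 i hi]⟩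
      zero_mem' := by simp
      smul_mem' := by
        rintro c a ⟨h1, h2⟩
        exact ⟨by simp [h1], fun i hi => by simp [h2 i hi]⟩ }
  let L : (Fin n → ℝ) →ₗ[ℝ] EuclideanSpace ℝ ι :=
    (WithLp.linearEquiv 2 ℝ (ι → ℝ)).symm.toLinearMap ∘ₗ B.mulVecLin
  have hL : ∀ w, L w = WithLp.toLp 2 (B.mulVec w) := fun w => rfl
  let K := W.map L
  let e : Fin n → ℝ := Pi.single p 1
  obtain ⟨w, hw, hwe⟩ := (Submodule.mem_map).1 (K.starProjection_apply_mem (L e))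
  have hea : ∀ i, i ∉ A → e i = 0 := fun i hi =>
    Pi.single_eq_of_ne (by rintro rfl; exact hi hp) _
  have hep : e p = 1 := Pi.single_eq_same _ _
  refine ⟨e - w, by simp [hep, hw.1], fun i hi => by simp [hea i hi, hw.2 i hi], ?_⟩
  intro v hv hv'
  rw [← hL, ← hL]
  have hm : e - v ∈ W := ⟨by simp [hep, hv], fun i hi => by simp [hea i hi, hv' i hi]⟩
  have hmem : L (e - v) ∈ K := Submodule.mem_map_of_mem hm
  have h1 : L (e - w) = L e - K.starProjection (L e) := by rw [map_sub, hwe]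
  have h2 : L v = L e - L (e - v) := by rw [map_sub]; abel
  rw [h1, h2]
  have := K.starProjection_minimal (L e)
  rw [this]
  exact ciInf_le ⟨0, by rintro _ ⟨x, rfl⟩; exact norm_nonneg _⟩ (⟨L (e - v), hmem⟩ : K)

theorem exists_isDirectionRule (B : Matrix ι (Fin n) ℝ) : ∃ dir, IsDirectionRule B dir := by
  classical
  refine ⟨fun z p => if h : p ∈ alive z then (exists_isStepDirection B _ p h).choose else 0, ?_⟩
  intro z p hp
  simp only [hp, dif_pos]
  exact (exists_isStepDirection B _ p hp).choose_spec

theorem feasibleSteps_props {z u : Fin n → ℝ} {p : Fin n} (hz : ∀ i, |z i| ≤ 1)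
    (hu : u p = 1) :
    IsCompact (feasibleSteps z u) ∧ (0 : ℝ) ∈ feasibleSteps z u := by
  have h0 : (0 : ℝ) ∈ feasibleSteps z u := fun i => by
    simpa using abs_le.1 (hz i)
  refine ⟨?_, h0⟩
  have hcl : IsClosed (feasibleSteps z u) := by
    have : feasibleSteps z u = ⋂ i, (fun δ : ℝ => z i + δ * u i) ⁻¹' Set.Icc (-1 : ℝ) 1 := by
      ext δ; simp [feasibleSteps]
    rw [this]
    exact isClosed_iInter fun i => isClosed_Icc.preimage (by fun_prop)
  refine (isCompact_Icc (a := (-2 : ℝ)) (b := 2)).of_isClosed_subset hcl ?_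
  intro δ hδ
  have h := hδ p
  have h' := abs_le.1 (hz p)
  rw [hu] at h
  constructor <;> linarith [h.1, h.2, h'.1, h'.2]

theorem step_mem_support {z u : Fin n → ℝ} {p : Fin n} (hz : ∀ i, |z i| ≤ 1)
    (hu : u p = 1) {δ : ℝ} (hδ : δ ∈ (stepSize z u).support) :
    δ ∈ feasibleSteps z u ∧
      (δ = sSup (feasibleSteps z u) ∨ δ = sInf (feasibleSteps z u)) := by
  obtain ⟨hc, h0⟩ := feasibleSteps_props hz hu
  have hne : (feasibleSteps z u).Nonempty := ⟨0, h0⟩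
  have hS : 0 ≤ sSup (feasibleSteps z u) := le_csSup hc.bddAbove h0
  have hI : sInf (feasibleSteps z u) ≤ 0 := csInf_le hc.bddBelow h0
  have hS' := hc.sSup_mem hne
  have hI' := hc.sInf_mem hne
  unfold stepSize at hδ
  rw [PMF.mem_support_map_iff] at hδ
  obtain ⟨b, -, rfl⟩ := hδ
  cases b
  · simp only [stepMinus, abs_of_nonpos hI, neg_neg, Bool.false_eq_true, if_false]
    exact ⟨hI', by simp⟩
  · simp only [stepPlus, abs_of_nonneg hS, if_true]
    exact ⟨hS', by simp⟩

theorem alive_ssubset {z u : Fin n → ℝ} {p : Fin n} (hz : ∀ i, |z i| ≤ 1) (hu : u p = 1)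
    (hu0 : ∀ i, i ∉ alive z → u i = 0) {δ : ℝ} (hδ : δ ∈ (stepSize z u).support) :
    alive (z + δ • u) ⊂ alive z := by
  obtain ⟨hmem, hext⟩ := step_mem_support hz hu hδ
  obtain ⟨hc, -⟩ := feasibleSteps_props hz hu
  have hsub : alive (z + δ • u) ⊆ alive z := by
    intro i hi
    by_contra h
    rw [mem_alive] at hi h
    exact h (by simpa [hu0 i (by rwa [mem_alive])] using hi)
  refine hsub.ssubset_of_ne fun heq => ?_
  have hnear : ∀ᶠ ε in nhds δ, ε ∈ feasibleSteps z u := by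
    unfold feasibleSteps
    simp only [Set.mem_ofPred_eq]
    rw [Filter.eventually_all]
    intro i
    by_cases hi : i ∈ alive z
    · have hi' : |z i + δ * u i| < 1 := by
        rw [← heq, mem_alive] at hi
        simpa using hi
      have hcont : Continuous fun ε : ℝ => |z i + ε * u i| := by fun_prop
      filter_upwards [hcont.continuousAt.eventually_lt_const hi'] with ε hε
      exact abs_le.1 hε.le
    · refine Filter.Eventually.of_forall fun ε => ?_
      simpa [hu0 i hi] using abs_le.1 (hz i)
  obtain ⟨r, hr, hball⟩ := Metric.eventually_nhds_iff.1 hnear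
  have h1 : δ + r / 2 ∈ feasibleSteps z u := hball (by
    rw [Real.dist_eq, abs_of_nonneg] <;> linarith)
  have h2 : δ - r / 2 ∈ feasibleSteps z u := hball (by
    rw [Real.dist_eq, abs_of_nonpos] <;> linarith)
  rcases hext with h | h
  · have := le_csSup hc.bddAbove h1
    linarith
  · have := csInf_le hc.bddBelow h2
    linarith

theorem stateLaw_support {B : Matrix ι (Fin n) ℝ} {dir : (Fin n → ℝ) → Fin n → Fin n → ℝ}
    (hdir : IsDirectionRule B dir) (t : ℕ) :
    ∀ s ∈ (stateLaw dir t).support,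
      (∀ i, |s.1 i| ≤ 1) ∧ (alive s.1).card + t ≤ n ∨
        (∀ i, |s.1 i| ≤ 1) ∧ alive s.1 = ∅ := by
  induction t with
  | zero =>
    intro s hs
    simp only [stateLaw, PMF.support_pure, Set.mem_singleton_iff] at hs
    subst hs
    exact Or.inl ⟨by simp, by simpa using Finset.card_le_univ (alive (0 : Fin n → ℝ))⟩
  | succ t ih =>
    intro s hs
    simp only [stateLaw, PMF.mem_support_bind_iff] at hs
    obtain ⟨s₀, hs₀, hs⟩ := hs
    have h₀ := ih s₀ hs₀
    have hz : ∀ i, |s₀.1 i| ≤ 1 := h₀.elim And.left And.left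
    unfold iteration at hs
    split_ifs at hs with hA
    · have hcard : (alive s₀.1).card + t ≤ n := by
        rcases h₀ with h | h
        · exact h.2
        · exact absurd h.2 hA.ne_empty
      rw [PMF.mem_support_bind_iff] at hs
      obtain ⟨p, hp, hs⟩ := hs
      rw [PMF.mem_support_map_iff] at hs
      obtain ⟨δ, hδ, rfl⟩ := hs
      have hpA : p ∈ alive s₀.1 := by
        rcases hq : s₀.2 with _ | q
        · simpa [hq, choosePivot] using hp
        · rw [hq] at hp
          by_cases hqA : q ∈ alive s₀.1
          · simp only [choosePivot, hqA, if_true, PMF.support_pure,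
              Set.mem_singleton_iff] at hp
            exact hp ▸ hqA
          · simpa [choosePivot, hqA] using hp
      have hd := hdir s₀.1 p hpA
      have hlt := Finset.card_lt_card
        (alive_ssubset hz hd.pivot_eq_one hd.eq_zero_of_notMem hδ)
      refine Or.inl ⟨fun i => ?_, by simp only; omega⟩
      have := (step_mem_support hz hd.pivot_eq_one hδ).1 i
      exact abs_le.2 (by simpa using this)
    · simp only [PMF.support_pure, Set.mem_singleton_iff] at hs
      subst hs
      exact Or.inr ⟨hz, Finset.not_nonempty_iff_eq_empty.1 hA⟩

/-- The assignments returned by the design are integral: each is `1` or `-1`. -/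
theorem design_integral {B : Matrix ι (Fin n) ℝ} {dir : (Fin n → ℝ) → Fin n → Fin n → ℝ}
    (hdir : IsDirectionRule B dir) (z : Fin n → ℝ) (hz : z ∈ (design dir).support) (i : Fin n) :
    z i = 1 ∨ z i = -1 := by
  unfold design at hz
  rw [PMF.mem_support_map_iff] at hz
  obtain ⟨s, hs, rfl⟩ := hz
  have h := stateLaw_support hdir n s hs
  have hle : |s.1 i| ≤ 1 := h.elim (fun h => h.1 i) (fun h => h.1 i)
  have he : alive s.1 = ∅ := by
    rcases h with h | h
    · exact Finset.card_eq_zero.1 (by omega)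
    · exact h.2
  have hn : ¬ |s.1 i| < 1 := by
    rw [← mem_alive, he]
    simp
  exact eq_or_eq_neg_of_abs_eq (le_antisymm hle (not_lt.1 hn))

end GSW

end

/-! Fix a test vector `v` and let `E(A)` be the squared length of the projection of `v` onto the
span of the columns indexed by `A`. For alive set `A` and pivot `p`, the potential is `⟪v, Bz⟫² +
E(A \ p) + (1 - z_p²) (E(A) - E(A \ p))`, or `⟪v, Bz⟫² + E(A)` without a pivot; the claim is that it
is a supermartingale.

By minimality, `Bu` is the Gram–Schmidt residual of the pivot column: it lies in the span of `A`, is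
orthogonal to the span of `A \ p`, and has norm at most that of the column, hence at most 1. So `⟪v,
Bu⟫² ≤ E(A) - E(A \ p)` (`IsStepDirection.inner_sq_le`). In a step `δ`, the gain `δ² ⟪v, Bu⟫²` is
thus paid for by the growth of `z_p²`; the terms linear in `δ` have mean zero, and freezing
coordinates only lowers `E` (`potential_step_le`, `expect_stepSize_le`). Changing a frozen pivot
does not raise the potential (`potential_choosePivot_le`).

The potential starts at `‖Pv‖² = vᵀPv` and always dominates `⟪v, Bz⟫²`, so the second moment, and a
fortiori the variance, of `⟪v, Bz⟫` is at most `vᵀPv`. -/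

noncomputable section

open scoped InnerProductSpace

/-! ### Expectations valued in `ENNReal`, which need no integrability along the induction. -/

namespace PMF

variable {α β : Type*}

/-- The expectation of an extended nonnegative function under a probability mass function. -/
def expect (q : PMF α) (f : α → ENNReal) : ENNReal := ∑' a, q a * f a

theorem expect_pure (a : α) (f : α → ENNReal) : (PMF.pure a).expect f = f a := by
  classical
  unfold expect
  rw [tsum_eq_single a]
  · simp
  · intro b hb
    simp [hb]

theorem expect_bind (q : PMF α) (g : α → PMF β) (f : β → ENNReal) :
    (q.bind g).expect f = q.expect fun a => (g a).expect f := by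
  unfold expect
  simp only [PMF.bind_apply, ← ENNReal.tsum_mul_right, ← ENNReal.tsum_mul_left]
  rw [ENNReal.tsum_comm]
  simp only [mul_assoc]

theorem expect_map (q : PMF α) (g : α → β) (f : β → ENNReal) :
    (q.map g).expect f = q.expect (f ∘ g) := by
  unfold PMF.map
  rw [expect_bind]
  simp only [Function.comp_apply, expect_pure, Function.comp_def]

theorem expect_mono (q : PMF α) {f g : α → ENNReal} (h : ∀ a ∈ q.support, f a ≤ g a) :
    q.expect f ≤ q.expect g := by
  refine ENNReal.tsum_le_tsum fun a => ?_
  by_cases ha : q a = 0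
  · simp [ha]
  · gcongr
    exact h a ((q.mem_support_iff a).2 ha)

theorem expect_const (q : PMF α) (c : ENNReal) : (q.expect fun _ => c) = c := by
  simp [expect, ENNReal.tsum_mul_right, q.tsum_coe]

theorem integral_toMeasure_eq_expect [MeasurableSpace α] [MeasurableSingletonClass α] (q : PMF α)
    {f : α → ℝ} (h0 : ∀ a, 0 ≤ f a) (hf : MeasureTheory.Integrable f q.toMeasure) :
    ∫ a, f a ∂q.toMeasure = (q.expect fun a => ENNReal.ofReal (f a)).toReal := by
  rw [PMF.integral_eq_tsum q f hf]
  unfold expect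
  rw [ENNReal.tsum_toReal_eq fun a => ENNReal.mul_ne_top (q.apply_ne_top a) ENNReal.ofReal_ne_top]
  simp [h0]

end PMF

/-! ### Projections onto nested subspaces, and orthogonality from minimality. -/

section Projection

variable {E : Type*} [NormedAddCommGroup E] [InnerProductSpace ℝ E]

/-- Pythagoras: the projection onto `V` is orthogonal to the difference of the two projections. -/
theorem Submodule.norm_starProjection_sub_sq {U V : Submodule ℝ E} [U.HasOrthogonalProjection]
    [V.HasOrthogonalProjection] (h : V ≤ U) (x : E) :
    ‖U.starProjection x - V.starProjection x‖ ^ 2 =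
      ‖U.starProjection x‖ ^ 2 - ‖V.starProjection x‖ ^ 2 := by
  have hV := V.starProjection_apply_mem x
  have h1 := U.starProjection_inner_eq_zero x _ (h hV)
  have h2 := V.starProjection_inner_eq_zero x _ hV
  rw [inner_sub_left] at h1 h2
  rw [norm_sub_sq_real, ← real_inner_self_eq_norm_sq (V.starProjection x)]
  linarith

theorem Submodule.norm_sq_starProjection_mono {U V : Submodule ℝ E} [U.HasOrthogonalProjection]
    [V.HasOrthogonalProjection] (h : V ≤ U) (x : E) :
    ‖V.starProjection x‖ ^ 2 ≤ ‖U.starProjection x‖ ^ 2 := by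
  have := Submodule.norm_starProjection_sub_sq h x
  nlinarith [sq_nonneg ‖U.starProjection x - V.starProjection x‖]

/-- Only the component of `x` in `U` orthogonal to `V` pairs with `r`; Cauchy–Schwarz then applies
to that component. -/
theorem Submodule.inner_sq_le_sub_of_mem_of_orthogonal {U V : Submodule ℝ E}
    [U.HasOrthogonalProjection] [V.HasOrthogonalProjection] (h : V ≤ U) (x : E) {r : E}
    (hrU : r ∈ U) (hrV : ∀ w ∈ V, ⟪r, w⟫_ℝ = 0) (hr : ‖r‖ ≤ 1) :
    ⟪x, r⟫_ℝ ^ 2 ≤ ‖U.starProjection x‖ ^ 2 - ‖V.starProjection x‖ ^ 2 := by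
  have h1 := U.starProjection_inner_eq_zero x r hrU
  have h2 := hrV _ (V.starProjection_apply_mem x)
  rw [real_inner_comm] at h2
  have h3 : ⟪x, r⟫_ℝ = ⟪U.starProjection x - V.starProjection x, r⟫_ℝ := by
    rw [inner_sub_left] at h1 ⊢
    linarith
  rw [← Submodule.norm_starProjection_sub_sq h, h3]
  apply sq_le_sq'
  · have := (abs_le.1 (abs_real_inner_le_norm (U.starProjection x - V.starProjection x) r)).1
    nlinarith [norm_nonneg (U.starProjection x - V.starProjection x)]
  · have := real_inner_le_norm (U.starProjection x - V.starProjection x) r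
    nlinarith [norm_nonneg (U.starProjection x - V.starProjection x)]

theorem real_inner_eq_zero_of_norm_le_add_smul {r b : E}
    (h : ∀ c : ℝ, ‖r‖ ≤ ‖r + c • b‖) : ⟪r, b⟫_ℝ = 0 := by
  by_cases hb : b = 0
  · simp [hb]
  have hb' : 0 < ‖b‖ ^ 2 := by positivity
  -- This value of `c` minimizes the quadratic `‖r + c • b‖²`.
  have h1 := pow_le_pow_left₀ (norm_nonneg _) (h (-⟪r, b⟫_ℝ / ‖b‖ ^ 2)) 2
  rw [norm_add_sq_real, inner_smul_right, norm_smul, mul_pow, Real.norm_eq_abs, sq_abs] at h1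
  have h2 : 2 * (-⟪r, b⟫_ℝ / ‖b‖ ^ 2 * ⟪r, b⟫_ℝ) + (-⟪r, b⟫_ℝ / ‖b‖ ^ 2) ^ 2 * ‖b‖ ^ 2 =
      -(⟪r, b⟫_ℝ ^ 2 / ‖b‖ ^ 2) := by
    field_simp
    ring
  have h3 : ⟪r, b⟫_ℝ ^ 2 / ‖b‖ ^ 2 ≤ 0 := by linarith
  have h4 := (div_le_iff₀ hb').1 h3
  rw [zero_mul] at h4
  exact pow_eq_zero_iff two_ne_zero |>.1 (le_antisymm h4 (sq_nonneg _))

end Projection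

/-! ### Step directions as Gram–Schmidt residuals. -/

namespace GSW

variable {n d : ℕ} {ι : Type*}

/-- `B u` as a vector of Euclidean space. -/
def image (B : Matrix ι (Fin n) ℝ) (u : Fin n → ℝ) : EuclideanSpace ℝ ι :=
  WithLp.toLp 2 (B.mulVec u)

theorem image_add (B : Matrix ι (Fin n) ℝ) (u w : Fin n → ℝ) :
    image B (u + w) = image B u + image B w := by
  simp [image, Matrix.mulVec_add]

theorem image_smul (B : Matrix ι (Fin n) ℝ) (c : ℝ) (u : Fin n → ℝ) :
    image B (c • u) = c • image B u := by
  simp [image, Matrix.mulVec_smul]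

theorem image_single (B : Matrix ι (Fin n) ℝ) (k : Fin n) :
    image B (Pi.single k 1) = WithLp.toLp 2 (B.col k) := by
  simp [image]

/-- The span of the columns of `B` with index in `A`. -/
def colSpan (B : Matrix ι (Fin n) ℝ) (A : Finset (Fin n)) : Submodule ℝ (EuclideanSpace ℝ ι) :=
  Submodule.span ℝ ((fun k => (WithLp.toLp 2 (B.col k) : EuclideanSpace ℝ ι)) '' A)

theorem colSpan_mono (B : Matrix ι (Fin n) ℝ) {A A' : Finset (Fin n)} (h : A ⊆ A') :
    colSpan B A ≤ colSpan B A' :=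
  Submodule.span_mono (Set.image_mono (by exact_mod_cast h))

theorem colSpan_univ (B : Matrix ι (Fin n) ℝ) : colSpan B Finset.univ = colSpace B := by
  simp [colSpan, colSpace]

theorem image_mem_colSpan (B : Matrix ι (Fin n) ℝ) {A : Finset (Fin n)} {u : Fin n → ℝ}
    (hu : ∀ i, i ∉ A → u i = 0) : image B u ∈ colSpan B A := by
  have h : image B u = ∑ k, u k • (WithLp.toLp 2 (B.col k) : EuclideanSpace ℝ ι) := by
    ext i
    simp [image, Matrix.mulVec, dotProduct, mul_comm]
  rw [h]
  refine Submodule.sum_mem _ fun k _ => ?_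
  by_cases hk : k ∈ A
  · exact Submodule.smul_mem _ _ (Submodule.subset_span ⟨k, hk, rfl⟩)
  · simp [hu k hk]

variable [Fintype ι]

namespace IsStepDirection

variable {B : Matrix ι (Fin n) ℝ} {A : Finset (Fin n)} {p : Fin n} {u : Fin n → ℝ}

/-- Perturbing `u` in an alive coordinate other than `p` keeps it admissible, so minimality forces
orthogonality to each such column. -/
theorem inner_eq_zero (h : IsStepDirection B A p u) {w : EuclideanSpace ℝ ι}
    (hw : w ∈ colSpan B (A.erase p)) : ⟪image B u, w⟫_ℝ = 0 := by
  refine Submodule.span_induction (p := fun w _ => ⟪image B u, w⟫_ℝ = 0) ?_ (by simp) ?_ ?_ hw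
  · rintro _ ⟨k, hk, rfl⟩
    have hk' := Finset.mem_erase.1 (Finset.mem_coe.1 hk)
    refine real_inner_eq_zero_of_norm_le_add_smul fun c => ?_
    have := h.norm_le (u + c • Pi.single k 1) (by simp [h.pivot_eq_one, hk'.1.symm]) ?_
    · change ‖image B _‖ ≤ ‖image B _‖ at this
      rwa [image_add, image_smul, image_single] at this
    · intro i hi
      have : i ≠ k := by
        rintro rfl
        exact hi hk'.2
      simp [h.eq_zero_of_notMem i hi, this]
  · intro x y _ _ hx hy
    rw [inner_add_right, hx, hy, add_zero]
  · intro c x _ hx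
    rw [inner_smul_right, hx, mul_zero]

theorem norm_image_le (h : IsStepDirection B A p u) (hp : p ∈ A) :
    ‖image B u‖ ≤ ‖(WithLp.toLp 2 (B.col p) : EuclideanSpace ℝ ι)‖ := by
  rw [← image_single]
  -- The basis vector at `p` is an admissible competitor.
  refine h.norm_le _ (by simp) fun i hi => ?_
  have : i ≠ p := by
    rintro rfl
    exact hi hp
  simp [this]

end IsStepDirection

/-! ### The potential and its change in one step. -/

/-- The squared length of the projection of `v` onto the span of the columns indexed by `A`. -/
def energy (B : Matrix ι (Fin n) ℝ) (v : EuclideanSpace ℝ ι) (A : Finset (Fin n)) : ℝ :=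
  ‖(colSpan B A).starProjection v‖ ^ 2

theorem energy_nonneg (B : Matrix ι (Fin n) ℝ) (v : EuclideanSpace ℝ ι) (A : Finset (Fin n)) :
    0 ≤ energy B v A := sq_nonneg _

theorem energy_mono (B : Matrix ι (Fin n) ℝ) (v : EuclideanSpace ℝ ι) {A A' : Finset (Fin n)}
    (h : A ⊆ A') : energy B v A ≤ energy B v A' :=
  Submodule.norm_sq_starProjection_mono (colSpan_mono B h) v

theorem IsStepDirection.inner_sq_le {B : Matrix ι (Fin n) ℝ} {A : Finset (Fin n)} {p : Fin n}
    {u : Fin n → ℝ} (h : IsStepDirection B A p u) (hp : p ∈ A)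
    (hB : ‖(WithLp.toLp 2 (B.col p) : EuclideanSpace ℝ ι)‖ ≤ 1) (v : EuclideanSpace ℝ ι) :
    ⟪v, image B u⟫_ℝ ^ 2 ≤ energy B v A - energy B v (A.erase p) :=
  Submodule.inner_sq_le_sub_of_mem_of_orthogonal (colSpan_mono B (A.erase_subset p)) v
    (image_mem_colSpan B h.eq_zero_of_notMem) (fun _ hw => h.inner_eq_zero hw)
    ((h.norm_image_le hp).trans hB)

/-- An upper bound for the expected energy that the walk still adds to `⟪v, B z⟫²`. -/
def pending (B : Matrix ι (Fin n) ℝ) (v : EuclideanSpace ℝ ι) (z : Fin n → ℝ) :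
    Option (Fin n) → ℝ
  | none => energy B v (alive z)
  -- The weight `1 - z_p²` is the part of the pivot's variance budget not yet spent; at `z_p = ±1`
  -- the pivot's contribution is gone.
  | some p => z p ^ 2 * energy B v ((alive z).erase p) + (1 - z p ^ 2) * energy B v (alive z)

/-- The potential of a state, which does not increase in expectation along the walk. -/
def potential (B : Matrix ι (Fin n) ℝ) (v : EuclideanSpace ℝ ι) (s : State n) : ℝ :=
  ⟪v, image B s.1⟫_ℝ ^ 2 + pending B v s.1 s.2

theorem pending_nonneg (B : Matrix ι (Fin n) ℝ) (v : EuclideanSpace ℝ ι) {z : Fin n → ℝ}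
    (hz : ∀ i, |z i| ≤ 1) (o : Option (Fin n)) : 0 ≤ pending B v z o := by
  rcases o with _ | p
  · exact energy_nonneg _ _ _
  · have := (sq_le_one_iff_abs_le_one (z p)).2 (hz p)
    exact add_nonneg (mul_nonneg (sq_nonneg _) (energy_nonneg _ _ _))
      (mul_nonneg (by linarith) (energy_nonneg _ _ _))

theorem pending_some_le (B : Matrix ι (Fin n) ℝ) (v : EuclideanSpace ℝ ι) (z : Fin n → ℝ)
    (p : Fin n) : pending B v z (some p) ≤ energy B v (alive z) := by
  have := energy_mono B v ((alive z).erase_subset p)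
  simp only [pending]
  nlinarith [sq_nonneg (z p)]

theorem pending_some_of_notMem (B : Matrix ι (Fin n) ℝ) (v : EuclideanSpace ℝ ι) (z : Fin n → ℝ)
    {p : Fin n} (hp : p ∉ alive z) : pending B v z (some p) = energy B v (alive z) := by
  rw [pending, Finset.erase_eq_of_notMem hp]
  ring

theorem alive_add_smul_subset {z u : Fin n → ℝ} (hu : ∀ i, i ∉ alive z → u i = 0) (δ : ℝ) :
    alive (z + δ • u) ⊆ alive z := by
  intro i hi
  by_contra h
  rw [mem_alive] at hi h
  exact h (by simpa [hu i (by rwa [mem_alive])] using hi)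

/-- A feasible step changes the potential by at most a linear function of the step size. -/
theorem potential_step_le {B : Matrix ι (Fin n) ℝ} {z u : Fin n → ℝ} {p : Fin n}
    (h : IsStepDirection B (alive z) p u) (hp : p ∈ alive z)
    (hB : ‖(WithLp.toLp 2 (B.col p) : EuclideanSpace ℝ ι)‖ ≤ 1) (v : EuclideanSpace ℝ ι)
    {δ : ℝ} (hδ : δ ∈ feasibleSteps z u) :
    potential B v (z + δ • u, some p) ≤ potential B v (z, some p) +
      δ * (2 * (⟪v, image B z⟫_ℝ * ⟪v, image B u⟫_ℝ) -
        2 * z p * (energy B v (alive z) - energy B v ((alive z).erase p))) := by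
  have hsub := alive_add_smul_subset h.eq_zero_of_notMem δ
  have h1 := energy_mono B v hsub
  have h2 := energy_mono B v (Finset.erase_subset_erase p hsub)
  have h3 := h.inner_sq_le hp hB v
  have h4 : (z p + δ) ^ 2 ≤ 1 := by
    have := hδ p
    rw [h.pivot_eq_one, mul_one] at this
    exact (sq_le_one_iff_abs_le_one _).2 (abs_le.2 this)
  have h5 : (z + δ • u) p = z p + δ := by simp [h.pivot_eq_one]
  simp only [potential, pending, h5, image_add, image_smul, inner_add_right, inner_smul_right]
  -- `h6` and `h7` replace the new alive set by the old one, both weights being nonnegative in the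
  -- cube; `h8` makes the coefficient of `δ²` nonpositive.
  have h6 := mul_le_mul_of_nonneg_left h2 (sq_nonneg (z p + δ))
  have h7 := mul_le_mul_of_nonneg_left h1 (sub_nonneg.2 h4)
  have h8 := mul_le_mul_of_nonneg_left h3 (sq_nonneg δ)
  linarith

/-- The random step size has mean zero. -/
theorem expect_stepSize_le {z u : Fin n → ℝ} {p : Fin n} (hz : ∀ i, |z i| ≤ 1) (hu : u p = 1)
    {f : ℝ → ℝ} {a b : ℝ} (hf0 : ∀ δ ∈ feasibleSteps z u, 0 ≤ f δ)
    (hf : ∀ δ ∈ feasibleSteps z u, f δ ≤ a + δ * b) :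
    ((stepSize z u).expect fun δ => ENNReal.ofReal (f δ)) ≤ ENNReal.ofReal a := by
  obtain ⟨hc, h0⟩ := feasibleSteps_props hz hu
  have hne : (feasibleSteps z u).Nonempty := ⟨0, h0⟩
  have hP : stepPlus z u ∈ feasibleSteps z u := by
    rw [stepPlus, abs_of_nonneg (le_csSup hc.bddAbove h0)]
    exact hc.sSup_mem hne
  have hM : -stepMinus z u ∈ feasibleSteps z u := by
    rw [stepMinus, abs_of_nonpos (csInf_le hc.bddBelow h0), neg_neg]
    exact hc.sInf_mem hne
  have hP0 : 0 ≤ stepPlus z u := abs_nonneg _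
  have hM0 : 0 ≤ stepMinus z u := abs_nonneg _
  set π := stepMinus z u / (stepPlus z u + stepMinus z u) with hπ
  have hπ0 : 0 ≤ π := div_nonneg hM0 (add_nonneg hP0 hM0)
  have hπ1 : π ≤ 1 := div_le_one_of_le₀ (by linarith) (add_nonneg hP0 hM0)
  have hmean : π * stepPlus z u = (1 - π) * stepMinus z u := by
    -- If both step lengths vanish, the identity holds whatever value the division by zero gives
    -- `π`.
    rcases (add_nonneg hP0 hM0).eq_or_lt with h | h
    · have h1 : stepPlus z u = 0 := by linarith
      have h2 : stepMinus z u = 0 := by linarith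
      simp [h1, h2]
    · rw [hπ]
      field_simp
      ring
  rw [stepSize, PMF.expect_map, PMF.expect, tsum_bool]
  have hpr : (probPlus z u : ENNReal) = ENNReal.ofReal π := rfl
  simp only [PMF.ofFintype_apply, Function.comp_apply, Bool.false_eq_true, if_false, if_true, hpr]
  rw [← ENNReal.ofReal_one, ← ENNReal.ofReal_sub _ hπ0, ← ENNReal.ofReal_mul (by linarith),
    ← ENNReal.ofReal_mul hπ0,
    ← ENNReal.ofReal_add (mul_nonneg (by linarith) (hf0 _ hM)) (mul_nonneg hπ0 (hf0 _ hP))]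
  apply ENNReal.ofReal_le_ofReal
  have h1 := mul_le_mul_of_nonneg_left (hf _ hM) (sub_nonneg.2 hπ1)
  have h2 := mul_le_mul_of_nonneg_left (hf _ hP) hπ0
  have h3 := congrArg (· * b) hmean
  linarith

/-- The last alternative treats a missing pivot and a frozen one alike: in both cases the pending
term is the full energy of the alive set. -/
theorem choosePivot_support {A : Finset (Fin n)} (hA : A.Nonempty) {o : Option (Fin n)}
    {p : Fin n} (hp : p ∈ (choosePivot A hA o).support) :
    p ∈ A ∧ (o = some p ∨ ∀ q, o = some q → q ∉ A) := by
  rcases o with _ | q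
  · exact ⟨by simpa [choosePivot] using hp, by simp⟩
  · by_cases hq : q ∈ A
    · simp only [choosePivot, hq, if_true, PMF.support_pure, Set.mem_singleton_iff] at hp
      exact ⟨hp ▸ hq, by simp [hp]⟩
    · exact ⟨by simpa [choosePivot, hq] using hp, by simp [hq]⟩

theorem potential_choosePivot_le (B : Matrix ι (Fin n) ℝ) (v : EuclideanSpace ℝ ι) (s : State n)
    (hA : (alive s.1).Nonempty) {p : Fin n} (hp : p ∈ (choosePivot (alive s.1) hA s.2).support) :
    potential B v (s.1, some p) ≤ potential B v s := by
  obtain ⟨z, o⟩ := s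
  refine add_le_add le_rfl ?_
  change pending B v z (some p) ≤ pending B v z o
  rcases (choosePivot_support hA hp).2 with h | h
  · exact (congrArg (pending B v z) h).ge
  · refine (pending_some_le B v z p).trans ?_
    rcases o with _ | q
    · exact le_rfl
    · rw [pending_some_of_notMem B v z (h q rfl)]

theorem potential_nonneg (B : Matrix ι (Fin n) ℝ) (v : EuclideanSpace ℝ ι) {s : State n}
    (hz : ∀ i, |s.1 i| ≤ 1) : 0 ≤ potential B v s :=
  add_nonneg (sq_nonneg _) (pending_nonneg B v hz _)

/-! ### The supermartingale property and the second moment bound. -/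

theorem expect_iteration_potential_le {B : Matrix ι (Fin n) ℝ}
    {dir : (Fin n → ℝ) → Fin n → Fin n → ℝ} (hdir : IsDirectionRule B dir)
    (hB : ∀ k, ‖(WithLp.toLp 2 (B.col k) : EuclideanSpace ℝ ι)‖ ≤ 1) (v : EuclideanSpace ℝ ι)
    {s : State n} (hz : ∀ i, |s.1 i| ≤ 1) :
    ((iteration dir s).expect fun s' => ENNReal.ofReal (potential B v s')) ≤
      ENNReal.ofReal (potential B v s) := by
  unfold iteration
  split_ifs with hA
  · rw [PMF.expect_bind, ← PMF.expect_const (choosePivot (alive s.1) hA s.2)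
      (ENNReal.ofReal (potential B v s))]
    refine PMF.expect_mono _ fun p hp => ?_
    have hpA := (choosePivot_support hA hp).1
    have hd := hdir s.1 p hpA
    refine le_trans ?_ (ENNReal.ofReal_le_ofReal (potential_choosePivot_le B v s hA hp))
    rw [PMF.expect_map]
    refine expect_stepSize_le hz hd.pivot_eq_one ?_
      fun δ hδ => potential_step_le hd hpA (hB p) v hδ
    intro δ hδ
    exact potential_nonneg B v fun i => abs_le.2 (by simpa using hδ i)
  · rw [PMF.expect_pure]

theorem expect_stateLaw_potential_le {B : Matrix ι (Fin n) ℝ}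
    {dir : (Fin n → ℝ) → Fin n → Fin n → ℝ} (hdir : IsDirectionRule B dir)
    (hB : ∀ k, ‖(WithLp.toLp 2 (B.col k) : EuclideanSpace ℝ ι)‖ ≤ 1) (v : EuclideanSpace ℝ ι)
    (t : ℕ) :
    ((stateLaw dir t).expect fun s => ENNReal.ofReal (potential B v s)) ≤
      ENNReal.ofReal (‖(colSpace B).starProjection v‖ ^ 2) := by
  induction t with
  | zero =>
    -- At the start every unit is alive and there is no pivot, so the potential is exactly the
    -- bound.
    have h : alive (0 : Fin n → ℝ) = Finset.univ := by
      ext i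
      simp [mem_alive]
    simp [stateLaw, PMF.expect_pure, potential, pending, energy, image, h, colSpan_univ]
  | succ t ih =>
    rw [stateLaw, PMF.expect_bind]
    refine le_trans (PMF.expect_mono _ fun s hs => ?_) ih
    exact expect_iteration_potential_le hdir hB v
      ((stateLaw_support hdir t s hs).elim And.left And.left)

theorem expect_design_inner_sq_le {B : Matrix ι (Fin n) ℝ}
    {dir : (Fin n → ℝ) → Fin n → Fin n → ℝ} (hdir : IsDirectionRule B dir)
    (hB : ∀ k, ‖(WithLp.toLp 2 (B.col k) : EuclideanSpace ℝ ι)‖ ≤ 1) (v : EuclideanSpace ℝ ι) :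
    ((design dir).expect fun z => ENNReal.ofReal (⟪v, image B z⟫_ℝ ^ 2)) ≤
      ENNReal.ofReal (‖(colSpace B).starProjection v‖ ^ 2) := by
  rw [design, PMF.expect_map]
  refine le_trans (PMF.expect_mono _ fun s hs => ?_) (expect_stateLaw_potential_le hdir hB v n)
  refine ENNReal.ofReal_le_ofReal (le_add_of_nonneg_right (pending_nonneg B v ?_ _))
  exact (stateLaw_support hdir n s hs).elim And.left And.left

/-! ### From second moments to the covariance matrix. -/

open MeasureTheory ProbabilityTheory

theorem ae_design_abs_le_one {B : Matrix ι (Fin n) ℝ} {dir : (Fin n → ℝ) → Fin n → Fin n → ℝ}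
    (hdir : IsDirectionRule B dir) : ∀ᵐ z ∂(design dir).toMeasure, ∀ i, |z i| ≤ 1 := by
  rw [ae_all_iff]
  intro i
  rw [ae_iff, PMF.toMeasure_apply_eq_zero_iff]
  · rw [Set.disjoint_left]
    intro z hz hz'
    refine hz' ?_
    rcases design_integral hdir z hz i with h | h <;> simp [h]
  · exact (measurableSet_le (f := fun z : Fin n → ℝ => |z i|) (by fun_prop)
      measurable_const).compl

/-- Square integrability, here from boundedness, is what permits expanding covariances of sums
bilinearly. -/
theorem memLp_design_mulVec {B : Matrix ι (Fin n) ℝ} {dir : (Fin n → ℝ) → Fin n → Fin n → ℝ}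
    (hdir : IsDirectionRule B dir) (i : ι) :
    MemLp (fun z => B.mulVec z i) 2 (design dir).toMeasure := by
  refine MemLp.of_bound (Measurable.aestronglyMeasurable ?_) (∑ k, |B i k|) ?_
  · unfold Matrix.mulVec dotProduct
    fun_prop
  · filter_upwards [ae_design_abs_le_one hdir] with z hz
    refine (Finset.abs_sum_le_sum_abs (fun k => B i k * z k) Finset.univ).trans
      (Finset.sum_le_sum fun k _ => ?_)
    rw [abs_mul]
    exact mul_le_of_le_one_right (abs_nonneg _) (hz k)

/-- If the columns of `B` have norm at most one, the covariance of `B z` is bounded by the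
projection onto the column space. -/
theorem posSemidef_colProj_sub_covMulVec [DecidableEq ι] {B : Matrix ι (Fin n) ℝ}
    {dir : (Fin n → ℝ) → Fin n → Fin n → ℝ} (hdir : IsDirectionRule B dir)
    (hB : ∀ k, ‖(WithLp.toLp 2 (B.col k) : EuclideanSpace ℝ ι)‖ ≤ 1) :
    (colProj B - covMulVec B (design dir)).PosSemidef := by
  have hproj : Matrix.toEuclideanCLM (𝕜 := ℝ) (n := ι) (colProj B) =
      (colSpace B).starProjection := StarAlgEquiv.apply_symm_apply _ _
  refine Matrix.PosSemidef.of_dotProduct_mulVec_nonneg (Matrix.IsHermitian.sub ?_ ?_) fun v => ?_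
  · change star (colProj B) = colProj B
    -- Symmetry is checked on operators, since the equivalence respects adjoints.
    apply EquivLike.injective (Matrix.toEuclideanCLM (𝕜 := ℝ) (n := ι))
    rw [map_star, hproj]
    exact isSelfAdjoint_starProjection _
  · ext i j
    simp [covMulVec, covariance_comm]
  set y : EuclideanSpace ℝ ι := WithLp.toLp 2 v with hy
  have himage : ∀ z, ⟪y, image B z⟫_ℝ = ∑ i, v i * B.mulVec z i := fun z => by
    simp [hy, image, PiLp.inner_apply, mul_comm]
  have hmem : MemLp (fun z => ⟪y, image B z⟫_ℝ) 2 (design dir).toMeasure := by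
    simp only [himage]
    exact memLp_finsetSum _ fun i _ => (memLp_design_mulVec hdir i).const_mul (v i)
  have hcov : dotProduct v ((covMulVec B (design dir)).mulVec v) =
      Var[fun z => ⟪y, image B z⟫_ℝ; (design dir).toMeasure] := by
    rw [← covariance_self hmem.aemeasurable]
    simp only [himage]
    rw [covariance_fun_sum_fun_sum (fun i => (memLp_design_mulVec hdir i).const_mul (v i))
      (fun i => (memLp_design_mulVec hdir i).const_mul (v i))]
    refine Finset.sum_congr rfl fun i _ => ?_
    rw [Matrix.mulVec, dotProduct, Finset.mul_sum]
    refine Finset.sum_congr rfl fun j _ => ?_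
    rw [covariance_const_mul_left, covariance_const_mul_right, covMulVec, Matrix.of_apply]
    ring
  have hquad : dotProduct v ((colProj B).mulVec v) = ‖(colSpace B).starProjection y‖ ^ 2 := by
    have h := Matrix.inner_toEuclideanCLM (colProj B) y y
    have h0 := (colSpace B).starProjection_inner_eq_zero y _
      ((colSpace B).starProjection_apply_mem y)
    rw [hproj] at h
    rw [inner_sub_left, real_inner_self_eq_norm_sq] at h0
    exact h.symm.trans (sub_eq_zero.1 h0)
  have hvar : Var[fun z => ⟪y, image B z⟫_ℝ; (design dir).toMeasure] ≤
      ‖(colSpace B).starProjection y‖ ^ 2 := by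
    -- The mean of `z` is never computed: dropping its square only helps.
    refine (variance_le_expectation_sq hmem.aestronglyMeasurable).trans ?_
    have := PMF.integral_toMeasure_eq_expect (design dir)
      (fun z => sq_nonneg ⟪y, image B z⟫_ℝ) hmem.integrable_sq
    refine this.trans_le ?_
    exact ENNReal.toReal_le_of_le_ofReal (sq_nonneg _) (expect_design_inner_sq_le hdir hB y)
  rw [star_trivial, Matrix.sub_mulVec, dotProduct_sub, hcov, hquad]
  exact sub_nonneg.2 hvar

/-! ### Columns of the augmented matrix have norm at most one. -/

theorem norm_row_le_maxRowNorm (X : Matrix (Fin n) (Fin d) ℝ) (k : Fin n) :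
    ‖(WithLp.toLp 2 (X k) : EuclideanSpace ℝ (Fin d))‖ ≤ maxRowNorm X :=
  le_ciSup (f := fun i => ‖(WithLp.toLp 2 (X i) : EuclideanSpace ℝ (Fin d))‖)
    (Set.finite_range _).bddAbove k

/-- The squared norm is `φ + (1 - φ) ξ⁻² ‖x_k‖²`, a convex combination of 1 and a number in `[0,
1]`. -/
theorem norm_col_augmented_le_one (X : Matrix (Fin n) (Fin d) ℝ) {φ : ℝ} (h0 : 0 ≤ φ)
    (h1 : φ ≤ 1) (k : Fin n) :
    ‖(WithLp.toLp 2 ((augmented X φ).col k) : EuclideanSpace ℝ (Fin n ⊕ Fin d))‖ ≤ 1 := by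
  have hk := norm_row_le_maxRowNorm X k
  rw [← sq_le_one_iff₀ (norm_nonneg _), EuclideanSpace.norm_sq_eq]
  have hx := EuclideanSpace.norm_sq_eq (WithLp.toLp 2 (X k) : EuclideanSpace ℝ (Fin d))
  -- This covers `ξ = 0` too, where the inverse is `0`.
  have hle : (maxRowNorm X)⁻¹ * ‖(WithLp.toLp 2 (X k) : EuclideanSpace ℝ (Fin d))‖ ≤ 1 := by
    rw [mul_comm, ← div_eq_mul_inv]
    exact div_le_one_of_le₀ hk ((norm_nonneg _).trans hk)
  have hle0 : 0 ≤ (maxRowNorm X)⁻¹ * ‖(WithLp.toLp 2 (X k) : EuclideanSpace ℝ (Fin d))‖ :=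
    mul_nonneg (inv_nonneg.2 ((norm_nonneg _).trans hk)) (norm_nonneg _)
  have hsq := (sq_le_one_iff₀ hle0).2 hle
  simp only [Real.norm_eq_abs, sq_abs] at hx
  rw [mul_pow, hx] at hsq
  have hone : ∑ i, (√φ * (1 : Matrix (Fin n) (Fin n) ℝ) i k) ^ 2 = φ := by
    simp [Matrix.one_apply, Real.sq_sqrt h0]
  have htwo : ∑ j, ((maxRowNorm X)⁻¹ * √(1 - φ) * X k j) ^ 2 =
      (1 - φ) * ((maxRowNorm X)⁻¹ ^ 2 * ∑ j, X k j ^ 2) := by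
    simp only [mul_pow, Real.sq_sqrt (sub_nonneg.2 h1), ← Finset.mul_sum]
    ring
  simp only [Fintype.sum_sum_type, Real.norm_eq_abs, sq_abs, augmented, Matrix.col_apply,
    Matrix.fromRows_apply_inl, Matrix.fromRows_apply_inr, Matrix.smul_apply, smul_eq_mul,
    Matrix.transpose_apply]
  rw [hone, htwo]
  nlinarith

end GSW

end

theorem mainTheorem1 (n d : ℕ) (X : Matrix (Fin n) (Fin d) ℝ) (φ : ℝ)
    (hφ0 : 0 ≤ φ) (hφ1 : φ ≤ 1)
    (dir : (Fin n → ℝ) → Fin n → Fin n → ℝ)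
    (hdir : GSW.IsDirectionRule (GSW.augmented X φ) dir) :
    (GSW.colProj (GSW.augmented X φ) -
      GSW.covMulVec (GSW.augmented X φ) (GSW.design dir)).PosSemidef :=
  GSW.posSemidef_colProj_sub_covMulVec hdir (GSW.norm_col_augmented_le_one X hφ0 hφ1)
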